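/- Let $\sigma>0$ (volatility), $\Delta t>0$ (mean interblock time). The fundamental price follows a geometric Brownian motion $dP_t/P_t=\mu\,dt+\sigma\,dW_t$, $P_0>0$, and the seller's ask price is $A_t=A_0e^{-\lambda t}$ with $A_0>0$, $\lambda>0$. Let $z_t=\log(A_t/P_t)$, $z_0=\log(A_0/P_0)\in\mathbb R$, and assume $\delta:=\lambda+\mu-\tfrac12\sigma^2>0$. Blocks are generated at the arrival times of a Poisson process of rate $1/\Delta t$ independent of $W$. The fill time $\tau_F$ is the earliest block generation time with $z_{\tau_F}\le 0$; it exists almost surely, and $\mathsf{LVF}(z_0):=\mathbb E[1-e^{z_{\tau_F}}]$ is well defined. For $\delta>0$ put \[ \mathsf{LVF}_+(\delta):=\frac{1}{1+\frac{\delta}{\sigma^2}\Bigl(\sqrt{1+\frac{2\sigma^2}{\delta^2\Delta t}}-1\Bigr)},\qquad \underline{\mathsf{LVF}}(\Delta t):=\frac{1}{1+\frac{1}{\sigma\sqrt{\Delta t/2}}}, \] where $\mathsf{LVF}_+(\delta)$ is the common value of $\mathsf{LVF}(z_0)$ for all $z_0\ge 0$. Then: 1. $\delta\mapsto\mathsf{LVF}_+(\delta)$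 is strictly increasing on $(0,\infty)$, and $\lim_{\delta\downarrow0}\mathsf{LVF}_+(\delta)=\underline{\mathsf{LVF}}(\Delta t)$. 2. For every $\delta>0$ and every $z_0\in\mathbb R$, $\ \underline{\mathsf{LVF}}(\Delta t)\le\mathsf{LVF}_+(\delta)\le\mathsf{LVF}(z_0)$. 3. For fixed $\sigma$, $\underline{\mathsf{LVF}}(\Delta t)\sim\sigma\sqrt{\Delta t/2}$ as $\Delta t\downarrow 0$ (the ratio tends to $1$). In particular, no choice of $(z_0,\delta)$ makes the expected relative loss smaller than $\underline{\mathsf{LVF}}(\Delta t)$. -/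

import Mathlib

open MeasureTheory ProbabilityTheory Filter Topology Asymptotics
open scoped NNReal

universe u

namespace DutchAuction

noncomputable section

/-- The gaps of a sequence of arrival times: `T 0`, `T 1 - T 0`, `T 2 - T 1`, … -/
def interarrival {Ω : Type u} (T : ℕ → Ω → ℝ≥0) : ℕ → Ω → ℝ
  | 0, ω => (T 0 ω : ℝ)
  | n + 1, ω => (T (n + 1) ω : ℝ) - (T n ω : ℝ)

/-- `T 0, T 1, …` are the successive arrival times of a Poisson process of rate `r`:
the interarrival times are independent and exponentially distributed with rate `r`. -/
structure IsPoissonArrivals {Ω : Type u} [MeasurableSpace Ω] (T : ℕ → Ω → ℝ≥0) (r : ℝ)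
    (Pr : Measure Ω) : Prop where
  hasLaw : ∀ n, HasLaw (interarrival T n) (expMeasure r) Pr
  indep : iIndepFun (interarrival T) Pr

/-- Geometric Brownian motion `dP/P = μ dt + σ dW` started at `P₀`. -/
def price {Ω : Type u} (P₀ μ σ : ℝ) (W : ℝ≥0 → Ω → ℝ) (t : ℝ≥0) (ω : Ω) : ℝ :=
  P₀ * Real.exp ((μ - σ ^ 2 / 2) * (t : ℝ) + σ * W t ω)

/-- The ask price `dA/A = -lam dt` started at `A₀`. -/
def ask (A₀ lam : ℝ) (t : ℝ≥0) : ℝ :=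
  A₀ * Real.exp (-lam * (t : ℝ))

/-- The log mispricing `z_t = log (A_t / P_t)`. -/
def mispricing {Ω : Type u} (A₀ lam P₀ μ σ : ℝ) (W : ℝ≥0 → Ω → ℝ) (t : ℝ≥0) (ω : Ω) : ℝ :=
  Real.log (ask A₀ lam t / price P₀ μ σ W t ω)

/-- The block generation times at which the order can be filled: those with `z ≤ 0`. -/
def fillable {Ω : Type u} (z : ℝ≥0 → Ω → ℝ) (T : ℕ → Ω → ℝ≥0) (ω : Ω) : Set ℝ≥0 :=
  {t | (∃ n, T n ω = t) ∧ z t ω ≤ 0}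

/-- The fill time: the earliest block generation time with `z ≤ 0`. -/
def fillTime {Ω : Type u} (z : ℝ≥0 → Ω → ℝ) (T : ℕ → Ω → ℝ≥0) (ω : Ω) : ℝ≥0 :=
  sInf (fillable z T ω)

/-- The relative loss `1 - exp z` at the fill time. -/
def relativeLoss {Ω : Type u} (z : ℝ≥0 → Ω → ℝ) (T : ℕ → Ω → ℝ≥0) (ω : Ω) : ℝ :=
  1 - Real.exp (z (fillTime z T ω) ω)

/-- Loss-versus-fair: the expected relative loss at the fill time. -/
def LVF {Ω : Type u} [MeasurableSpace Ω] (z : ℝ≥0 → Ω → ℝ) (T : ℕ → Ω → ℝ≥0)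
    (Pr : Measure Ω) : ℝ :=
  ∫ ω, relativeLoss z T ω ∂Pr

/-- `LVF₊` as a function of volatility `σ`, mean interblock time `Δt` and drift `δ > 0`. -/
def LVFplus (σ Δt δ : ℝ) : ℝ :=
  1 / (1 + δ / σ ^ 2 * (Real.sqrt (1 + 2 * σ ^ 2 / (δ ^ 2 * Δt)) - 1))

/-- The lower bound for `LVF₊`. -/
def LVFfloor (σ Δt : ℝ) : ℝ :=
  1 / (1 + 1 / (σ * Real.sqrt (Δt / 2)))

end

end DutchAuction

/-!
Observed at the block times, the log mispricing is a random walk `z₀ - X₀ - ⋯ - Xₙ`, where the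
`Xᵢ` are displacements of `t ↦ δ t + σ W t` over independent exponential times of rate `1 / Δt`.
Given the block times the displacements are independent Gaussians whose parameters depend on the
gaps only, so the `Xᵢ` are independent with a common law (`measure_inter_increment_random`,
`exists_iid_steps`). Its characteristic function is a rational function, and factoring the
denominator shows that a step is `U - V` with `U`, `V` independent and exponential, of rates `a` and
`a + 2 δ / σ²` (`stepLaw_eq_map_sub`); moreover `LVFplus = 1 / (1 + a)`, where `a` is `ladderRate`.

By the memoryless property of `U`, a walk that crosses zero from a nonnegative position overshoots
it by an exponential variable `Y` of rate `a`, and the expected loss is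
`E[1 - exp (-Y)] = 1 / (1 + a)`. This is organised through the function `stepReward`, equal to the
loss `1 - exp z` for `z ≤ 0` and to the constant `1 / (1 + a)` for `z > 0`: evaluated along the walk
stopped at its first passage it is a bounded martingale, so `LVF (z₀) = E[stepReward (z₀ - X₀)]`
(`integral_reward_at_first_passage`). Averaging over `U` first, with `m = z₀ + V`, this is the mean
of `1 - exp (min m 0) * a / (1 + a)` (`integral_stepReward_sub_stepLaw`), which is always at least
`1 / (1 + a)`, with equality if `z₀ ≥ 0`. The first passage is almost surely finite because the
steps have an exponential moment smaller than one (`ae_exists_walk_nonpos`).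

The monotonicity in `δ` and the limits are read off from `a = (√(δ² + 2 σ² / Δt) - δ) / σ²`, which
is continuous and strictly decreasing in `δ`.
-/

namespace DutchAuction

/-! ### The closed form of the loss and its lower bound -/

/-- The positive root `a` of `σ² a² / 2 + δ a = 1 / Δt`, where `t ↦ σ² t² / 2 + δ t` is the Laplace
exponent of the Brownian motion with drift `t ↦ δ t + σ W t`. It is the rate of the exponential
law of the overshoot of this motion, sampled at block times, above a level. -/
noncomputable def ladderRate (σ Δt δ : ℝ) : ℝ :=
  (Real.sqrt (δ ^ 2 + 2 * σ ^ 2 / Δt) - δ) / σ ^ 2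

lemma ladderRate_pos {σ Δt : ℝ} (hσ : 0 < σ) (hΔ : 0 < Δt) (δ : ℝ) :
    0 < ladderRate σ Δt δ := by
  have h : |δ| < Real.sqrt (δ ^ 2 + 2 * σ ^ 2 / Δt) := by
    rw [← Real.sqrt_sq_eq_abs]
    exact Real.sqrt_lt_sqrt (sq_nonneg _) (lt_add_of_pos_right _ (by positivity))
  exact div_pos (sub_pos.2 ((le_abs_self δ).trans_lt h)) (by positivity)

lemma LVFplus_eq {σ Δt δ : ℝ} (hδ : 0 < δ) :
    LVFplus σ Δt δ = 1 / (1 + ladderRate σ Δt δ) := by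
  have h : δ ^ 2 + 2 * σ ^ 2 / Δt = δ ^ 2 * (1 + 2 * σ ^ 2 / (δ ^ 2 * Δt)) := by
    field_simp
  rw [LVFplus, ladderRate, h, Real.sqrt_mul (sq_nonneg δ), Real.sqrt_sq hδ.le]
  congr 2
  ring

lemma LVFfloor_eq {σ Δt : ℝ} (hσ : 0 < σ) (hΔ : 0 < Δt) :
    LVFfloor σ Δt = 1 / (1 + ladderRate σ Δt 0) := by
  have h : 2 * σ ^ 2 / Δt = (σ / Real.sqrt (Δt / 2)) ^ 2 := by
    rw [div_pow, Real.sq_sqrt (by positivity)]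
    field_simp
  have hs : 0 < Real.sqrt (Δt / 2) := Real.sqrt_pos.2 (by positivity)
  rw [LVFfloor, ladderRate, zero_pow two_ne_zero, zero_add, h, Real.sqrt_sq (by positivity)]
  congr 2
  field_simp
  ring

lemma continuous_ladderRate (σ Δt : ℝ) : Continuous (ladderRate σ Δt) := by
  unfold ladderRate
  fun_prop

lemma strictAnti_ladderRate {σ Δt : ℝ} (hσ : 0 < σ) (hΔ : 0 < Δt) :
    StrictAnti (ladderRate σ Δt) := by
  intro x y hxy
  refine div_lt_div_of_pos_right ?_ (by positivity)
  set k := 2 * σ ^ 2 / Δt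
  have hk : 0 < k := by positivity
  have hy : y < Real.sqrt (y ^ 2 + k) := Real.lt_sqrt_of_sq_lt (by linarith)
  have hx : x < Real.sqrt (x ^ 2 + k) := Real.lt_sqrt_of_sq_lt (by linarith)
  have hx0 := Real.sq_sqrt (show 0 ≤ x ^ 2 + k by positivity)
  have hy0 := Real.sq_sqrt (show 0 ≤ y ^ 2 + k by positivity)
  -- The two square roots differ by `(y² - x²) / (√(x² + k) + √(y² + k))`, less than `y - x`.
  by_contra! h
  have h1 := mul_pos (sub_pos.2 hxy) (sub_pos.2 (add_lt_add hx hy))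
  have h2 := mul_nonneg (sub_nonneg.2 h) (add_pos_of_nonneg_of_pos
    (Real.sqrt_nonneg (x ^ 2 + k)) (Real.sqrt_pos.2 (by positivity : 0 < y ^ 2 + k))).le
  nlinarith

lemma strictMonoOn_LVFplus {σ Δt : ℝ} (hσ : 0 < σ) (hΔ : 0 < Δt) :
    StrictMonoOn (fun δ : ℝ => LVFplus σ Δt δ) (Set.Ioi 0) := by
  intro x hx y hy hxy
  simp only [LVFplus_eq (Set.mem_Ioi.1 hx), LVFplus_eq (Set.mem_Ioi.1 hy)]
  exact one_div_lt_one_div_of_lt (by linarith [ladderRate_pos hσ hΔ y])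
    (by linarith [strictAnti_ladderRate hσ hΔ hxy])

lemma LVFfloor_le_LVFplus {σ Δt δ : ℝ} (hσ : 0 < σ) (hΔ : 0 < Δt) (hδ : 0 < δ) :
    LVFfloor σ Δt ≤ LVFplus σ Δt δ := by
  rw [LVFplus_eq hδ, LVFfloor_eq hσ hΔ]
  exact one_div_le_one_div_of_le (by linarith [ladderRate_pos hσ hΔ δ])
    (by linarith [strictAnti_ladderRate hσ hΔ hδ])

lemma tendsto_LVFplus {σ Δt : ℝ} (hσ : 0 < σ) (hΔ : 0 < Δt) :
    Tendsto (fun δ : ℝ => LVFplus σ Δt δ) (𝓝[>] (0 : ℝ)) (𝓝 (LVFfloor σ Δt)) := by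
  rw [LVFfloor_eq hσ hΔ]
  have h : Tendsto (fun δ : ℝ => 1 / (1 + ladderRate σ Δt δ)) (𝓝[>] (0 : ℝ))
      (𝓝 (1 / (1 + ladderRate σ Δt 0))) :=
    (tendsto_const_nhds.div
      (tendsto_const_nhds.add ((continuous_ladderRate σ Δt).tendsto 0))
      (by linarith [ladderRate_pos hσ hΔ 0])).mono_left nhdsWithin_le_nhds
  refine h.congr' ?_
  filter_upwards [self_mem_nhdsWithin] with δ hδ
  exact (LVFplus_eq hδ).symm

lemma isEquivalent_LVFfloor {σ : ℝ} (hσ : 0 < σ) :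
    (fun Δt : ℝ => LVFfloor σ Δt) ~[𝓝[>] (0 : ℝ)] (fun Δt : ℝ => σ * Real.sqrt (Δt / 2)) := by
  have hpos : ∀ᶠ Δt : ℝ in 𝓝[>] (0 : ℝ), 0 < σ * Real.sqrt (Δt / 2) := by
    filter_upwards [self_mem_nhdsWithin] with Δt hΔ
    exact mul_pos hσ (Real.sqrt_pos.2 (half_pos hΔ))
  rw [isEquivalent_iff_tendsto_one (hpos.mono fun _ h => h.ne')]
  have hc : Continuous fun Δt : ℝ => σ * Real.sqrt (Δt / 2) + 1 := by fun_prop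
  have h : Tendsto (fun Δt : ℝ => 1 / (σ * Real.sqrt (Δt / 2) + 1)) (𝓝[>] (0 : ℝ)) (𝓝 1) := by
    have := (tendsto_const_nhds (x := (1 : ℝ))).div (hc.tendsto 0) (by simp)
    simp only [zero_div, Real.sqrt_zero, mul_zero, zero_add, div_one] at this
    exact this.mono_left nhdsWithin_le_nhds
  refine h.congr' ?_
  filter_upwards [hpos] with Δt hΔ
  rw [Pi.div_apply, LVFfloor]
  generalize σ * Real.sqrt (Δt / 2) = x at hΔ
  field_simp

/-- The roots of `σ² x² / 2 + δ x = 1 / Δt` are `a` and `-(a + 2 δ / σ²)`. -/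
lemma ladderRate_mul {σ Δt : ℝ} (hσ : 0 < σ) (hΔ : 0 < Δt) (δ : ℝ) :
    ladderRate σ Δt δ * (ladderRate σ Δt δ + 2 * δ / σ ^ 2) * σ ^ 2 = 2 * (1 / Δt) := by
  have h := Real.sq_sqrt (show 0 ≤ δ ^ 2 + 2 * σ ^ 2 / Δt by positivity)
  rw [ladderRate]
  generalize Real.sqrt (δ ^ 2 + 2 * σ ^ 2 / Δt) = s at h
  have h' : (s - δ) / σ ^ 2 * ((s - δ) / σ ^ 2 + 2 * δ / σ ^ 2) * σ ^ 2
      = (s ^ 2 - δ ^ 2) / σ ^ 2 := by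
    field_simp
    ring
  rw [h', h]
  field_simp
  ring

/-! ### The exponential distribution -/

lemma integral_expMeasure {E : Type*} [NormedAddCommGroup E] [NormedSpace ℝ E] (r : ℝ)
    (hr : 0 < r) (f : ℝ → E) :
    ∫ x, f x ∂(expMeasure r) = ∫ x in Set.Ioi (0 : ℝ), (r * Real.exp (-(r * x))) • f x := by
  have h : expMeasure r = volume.withDensity (exponentialPDF r) := rfl
  have hm : Measurable (exponentialPDF r) := (measurable_exponentialPDFReal r).ennreal_ofReal
  rw [h, integral_withDensity_eq_integral_toReal_smul hm
    (ae_of_all _ fun _ => ENNReal.ofReal_lt_top),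
    ← integral_Ici_eq_integral_Ioi, ← integral_indicator measurableSet_Ici]
  refine integral_congr_ae (ae_of_all _ fun x => ?_)
  by_cases hx : 0 ≤ x
  · simp [exponentialPDF_eq, hx,
      ENNReal.toReal_ofReal (by positivity : 0 ≤ r * Real.exp (-(r * x)))]
  · simp [exponentialPDF_eq, hx]

lemma ae_pos_expMeasure (r : ℝ) : ∀ᵐ x ∂(expMeasure r), 0 < x := by
  have h : expMeasure r = volume.withDensity (exponentialPDF r) := rfl
  rw [ae_iff]
  simp only [not_lt]
  change expMeasure r (Set.Iic 0) = 0
  rw [h, withDensity_apply _ measurableSet_Iic, setLIntegral_congr Iio_ae_eq_Iic.symm]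
  exact lintegral_exponentialPDF_of_nonpos le_rfl

lemma integral_cexp_expMeasure {r : ℝ} (hr : 0 < r) {w : ℂ} (hw : w.re < r) :
    ∫ x : ℝ, Complex.exp (w * x) ∂(expMeasure r) = r / (r - w) := by
  have hne : (r : ℂ) - w ≠ 0 := fun h => by
    have := congrArg Complex.re h
    simp at this
    linarith
  have hne' : w - (r : ℂ) ≠ 0 := fun h => hne (by linear_combination -h)
  rw [integral_expMeasure r hr]
  have h : ∀ x : ℝ, (r * Real.exp (-(r * x))) • Complex.exp (w * x)
      = r * Complex.exp ((w - r) * x) := fun x => by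
    rw [Complex.real_smul, Complex.ofReal_mul, Complex.ofReal_exp, mul_assoc, ← Complex.exp_add]
    congr 2
    push_cast
    ring
  simp_rw [h]
  rw [integral_const_mul, integral_exp_mul_complex_Ioi (by simpa using hw)]
  simp only [Complex.ofReal_zero, mul_zero, Complex.exp_zero]
  field_simp
  ring

lemma integral_exp_expMeasure {r : ℝ} (hr : 0 < r) {w : ℝ} (hw : w < r) :
    ∫ x : ℝ, Real.exp (w * x) ∂(expMeasure r) = r / (r - w) := by
  rw [integral_expMeasure r hr]
  have h : ∀ x : ℝ, (r * Real.exp (-(r * x))) • Real.exp (w * x)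
      = r * Real.exp ((w - r) * x) := fun x => by
    rw [smul_eq_mul, mul_assoc, ← Real.exp_add]
    ring_nf
  simp_rw [h]
  have hne : w - r ≠ 0 := by linarith
  have hne' : r - w ≠ 0 := by linarith
  rw [integral_const_mul, integral_exp_mul_Ioi (by linarith)]
  simp only [mul_zero, Real.exp_zero]
  field_simp
  ring

/-! ### The law of the mispricing change between blocks -/

/-- The law of the displacement `δ e + σ B_e` of a Brownian motion with drift over a time `e ≥ 0`.
For `e < 0`, which exponential times exclude, the variance is truncated to zero. -/
noncomputable def displacement (δ σ : ℝ) : Kernel ℝ ℝ :=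
  ⟨fun e => gaussianReal (δ * e) (Real.toNNReal (σ ^ 2 * e)),
    measurable_gaussianReal.comp
      ((by fun_prop : Measurable fun e : ℝ => (δ * e, Real.toNNReal (σ ^ 2 * e))))⟩

instance (δ σ : ℝ) : IsMarkovKernel (displacement δ σ) :=
  ⟨fun e => inferInstanceAs (IsProbabilityMeasure
    (gaussianReal (δ * e) (Real.toNNReal (σ ^ 2 * e))))⟩

lemma integral_bind_kernel {α β E : Type*} [MeasurableSpace α] [MeasurableSpace β]
    [NormedAddCommGroup E] [NormedSpace ℝ E] {ν : Measure α} {κ : Kernel α β}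
    [IsFiniteMeasure ν] [IsMarkovKernel κ]
    {f : β → E} (hf : Integrable f (ν.bind κ)) :
    ∫ y, f y ∂(ν.bind κ) = ∫ x, ∫ y, f y ∂(κ x) ∂ν := by
  have h : ν.bind κ = (κ ∘ₖ Kernel.const Unit ν) () := by
    rw [Kernel.comp_apply, Kernel.const_apply]
  rw [h] at hf ⊢
  rw [Kernel.integral_comp hf, Kernel.const_apply]

/-- The law of the displacement of a Brownian motion with drift over an independent exponential
time of rate `r`, as between two consecutive blocks. -/
noncomputable def stepLaw (δ σ r : ℝ) : Measure ℝ :=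
  (expMeasure r).bind (displacement δ σ)

instance (r : ℝ) [Fact (0 < r)] : IsProbabilityMeasure (expMeasure r) :=
  isProbabilityMeasure_expMeasure Fact.out

instance (δ σ r : ℝ) [Fact (0 < r)] : IsProbabilityMeasure (stepLaw δ σ r) := by
  unfold stepLaw; infer_instance

/-- The Wiener–Hopf factorisation of the step: it is the difference of two independent exponential
variables. The hypotheses say that `a` and `-b` are the roots of `σ² x² / 2 + δ x = r`, so that the
two characteristic functions agree. -/
lemma stepLaw_eq_map_sub {δ σ r a b : ℝ} [hr : Fact (0 < r)] [ha : Fact (0 < a)]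
    [hb : Fact (0 < b)] (hσ : σ ≠ 0)
    (hab : a * b * σ ^ 2 = 2 * r) (hba : (b - a) * σ ^ 2 = 2 * δ) :
    stepLaw δ σ r = ((expMeasure a).prod (expMeasure b)).map (fun p => p.1 - p.2) := by
  have : IsProbabilityMeasure (((expMeasure a).prod (expMeasure b)).map (fun p => p.1 - p.2)) :=
    Measure.isProbabilityMeasure_map (by fun_prop)
  refine Measure.ext_of_charFun (funext fun t => ?_)
  have hl : charFun (stepLaw δ σ r) t
      = r / (r - (δ * t * Complex.I - σ ^ 2 * t ^ 2 / 2)) := by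
    rw [charFun_apply_real, stepLaw, integral_bind_kernel]
    · rw [← integral_cexp_expMeasure hr.out]
      · refine integral_congr_ae ?_
        filter_upwards [ae_pos_expMeasure r] with e he
        have : ∫ y : ℝ, Complex.exp (t * y * Complex.I) ∂(displacement δ σ e)
            = charFun (gaussianReal (δ * e) (Real.toNNReal (σ ^ 2 * e))) t :=
          (charFun_apply_real t).symm
        rw [this, charFun_gaussianReal]
        congr 1
        rw [show ((Real.toNNReal (σ ^ 2 * e) : ℝ≥0) : ℂ) = ((σ ^ 2 * e : ℝ) : ℂ) by
          rw [Real.coe_toNNReal _ (by positivity)]]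
        push_cast
        ring
      · have : 0 ≤ σ ^ 2 * t ^ 2 / 2 := by positivity
        have h2 := hr.out
        rw [show (δ * t * Complex.I - σ ^ 2 * t ^ 2 / 2 : ℂ)
          = ((-(σ ^ 2 * t ^ 2 / 2) : ℝ) : ℂ) + ((δ * t : ℝ) : ℂ) * Complex.I by push_cast; ring,
          Complex.add_re, Complex.ofReal_re, Complex.re_ofReal_mul, Complex.I_re]
        linarith
    · refine Integrable.of_bound (C := 1) (by fun_prop) (ae_of_all _ fun x => ?_)
      rw [show (t : ℂ) * x * Complex.I = ((t * x : ℝ) : ℂ) * Complex.I by push_cast; ring,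
        Complex.norm_exp_ofReal_mul_I]
  have hrr : charFun (((expMeasure a).prod (expMeasure b)).map (fun p => p.1 - p.2)) t
      = (a / (a - t * Complex.I)) * (b / (b - (-t * Complex.I))) := by
    rw [charFun_apply_real, integral_map (by fun_prop) (by fun_prop)]
    rw [← integral_cexp_expMeasure ha.out (w := t * Complex.I) (by simpa using ha.out),
      ← integral_cexp_expMeasure hb.out (w := -t * Complex.I) (by simpa using hb.out),
      ← integral_prod_mul]
    refine integral_congr_ae (ae_of_all _ fun p => ?_)
    simp only
    rw [← Complex.exp_add]
    push_cast
    ring_nf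
  rw [hl, hrr]
  have hac : (a : ℂ) - t * Complex.I ≠ 0 := fun h => by
    have := congrArg Complex.re h
    simp at this
    exact ha.out.ne' this
  have hbc : (b : ℂ) - (-t * Complex.I) ≠ 0 := fun h => by
    have := congrArg Complex.re h
    simp at this
    exact hb.out.ne' this
  have hσc : (σ : ℂ) ≠ 0 := by exact_mod_cast hσ
  have h1 : (a : ℂ) * b * σ ^ 2 = 2 * r := by exact_mod_cast hab
  have h2 : ((b : ℂ) - a) * σ ^ 2 = 2 * δ := by exact_mod_cast hba
  have hfac : (r : ℂ) - (δ * t * Complex.I - σ ^ 2 * t ^ 2 / 2)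
      = σ ^ 2 / 2 * ((a - t * Complex.I) * (b - (-t * Complex.I))) := by
    linear_combination (-1 / 2 : ℂ) * h1 + (t * Complex.I / 2) * h2
      + (σ ^ 2 * t ^ 2 / 2 : ℂ) * Complex.I_sq
  rw [hfac, show (r : ℂ) = σ ^ 2 / 2 * (a * b) by linear_combination (-1 / 2 : ℂ) * h1,
    mul_div_mul_left _ _ (by simpa using hσc), mul_div_mul_comm]

/-! ### The expected reward after one step -/

/-- The expected loss of a seller who has just seen the log mispricing `z` at a block: the order is
filled if `z ≤ 0`, and otherwise the loss still to be expected is `1 / (1 + a)`, whatever the value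
of `z`. -/
noncomputable def stepReward (a z : ℝ) : ℝ :=
  if z ≤ 0 then 1 - Real.exp z else 1 / (1 + a)

lemma measurable_stepReward (a : ℝ) : Measurable (stepReward a) :=
  Measurable.ite measurableSet_Iic (by fun_prop) measurable_const

lemma stepReward_mem_Icc {a : ℝ} (ha : 0 < a) (z : ℝ) : stepReward a z ∈ Set.Icc (0 : ℝ) 1 := by
  unfold stepReward
  split_ifs with h
  · exact ⟨by simpa using h, by linarith [Real.exp_pos z]⟩
  · exact ⟨by positivity, by rw [div_le_one (by positivity)]; linarith⟩

/-- The memoryless property of a downward exponential jump: started at `m ≥ 0`, it either stays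
above zero or overshoots zero by an exponential variable of the same rate, and the expected reward
is `1 / (1 + a)` in both cases. -/
lemma integral_stepReward_sub_expMeasure {a : ℝ} [ha : Fact (0 < a)] (m : ℝ) :
    ∫ u, stepReward a (m - u) ∂(expMeasure a) = 1 - Real.exp (min m 0) * (a / (1 + a)) := by
  have ha := ha.out
  have hint : ∀ m, Integrable (fun u => stepReward a (m - u)) (expMeasure a) := fun m =>
    Integrable.of_bound (C := 1)
      ((measurable_stepReward a).comp (by fun_prop)).aestronglyMeasurable
      (ae_of_all _ fun u => by
        have h := stepReward_mem_Icc ha (m - u)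
        rw [Real.norm_eq_abs, abs_le]
        exact ⟨by linarith [h.1], h.2⟩)
  rcases le_or_gt m 0 with hm | hm
  -- for `m ≤ 0` the jump ends below zero
  · have hexp : ∫ u : ℝ, Real.exp (-1 * u) ∂(expMeasure a) = a / (1 + a) := by
      rw [integral_exp_expMeasure ha (by linarith)]
      ring_nf
    have hi : Integrable (fun u : ℝ => Real.exp (-1 * u)) (expMeasure a) := by
      refine Integrable.of_bound (C := 1) (by fun_prop) ?_
      filter_upwards [ae_pos_expMeasure a] with u hu
      simpa using hu.le
    rw [min_eq_left hm, ← hexp, ← integral_const_mul]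
    have h1 : ∫ _ : ℝ, (1 : ℝ) ∂(expMeasure a) = 1 := by simp
    have h2 := integral_sub (integrable_const (1 : ℝ)) (hi.const_mul (Real.exp m))
    rw [h1] at h2
    rw [← h2]
    refine integral_congr_ae ?_
    filter_upwards [ae_pos_expMeasure a] with u hu
    rw [stepReward, if_pos (by linarith), ← Real.exp_add]
    ring_nf
  -- for `m > 0` the reward differs from `1 / (1 + a)` only after a jump of size at least `m`
  · have hc : ∫ u, (stepReward a (m - u) - 1 / (1 + a)) ∂(expMeasure a) = 0 := by
      rw [integral_expMeasure a ha,
        setIntegral_eq_of_subset_of_forall_sdiff_eq_zero measurableSet_Ioi (s := Set.Ici m)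
          (fun x hx => hm.trans_le hx), integral_Ici_eq_integral_Ioi]
      · have h : ∀ u ∈ Set.Ioi m, (a * Real.exp (-(a * u))) • (stepReward a (m - u) - 1 / (1 + a))
            = a * (a / (1 + a)) * Real.exp (-a * u)
              - a * Real.exp m * Real.exp (-(a + 1) * u) := by
          intro u hu
          rw [stepReward, if_pos (by linarith [Set.mem_Ioi.1 hu]),
            show -(a + 1) * u = -(a * u) + -u by ring, show m - u = m + -u by ring,
            Real.exp_add, Real.exp_add, smul_eq_mul, neg_mul]
          field_simp
          ring
        rw [setIntegral_congr_fun measurableSet_Ioi h, integral_sub, integral_const_mul,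
          integral_const_mul, integral_exp_mul_Ioi (by linarith),
          integral_exp_mul_Ioi (by linarith),
          show -(a + 1) * m = -a * m + -m by ring, Real.exp_add, Real.exp_neg m]
        · have := (Real.exp_pos m).ne'
          field_simp
          ring
        · exact (integrableOn_exp_mul_Ioi (by linarith) m).const_mul _
        · exact (integrableOn_exp_mul_Ioi (by linarith) m).const_mul _
      · intro u hu
        rw [stepReward, if_neg (by simpa using hu.2)]
        simp
    rw [integral_sub (hint m) (integrable_const _)] at hc
    rw [min_eq_right hm.le, Real.exp_zero, sub_eq_zero.1 hc]
    simp
    field_simp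
    ring

lemma integrable_stepReward_comp {Ω : Type*} [MeasurableSpace Ω] {P : Measure Ω}
    [IsFiniteMeasure P] {a : ℝ} (ha : 0 < a) {f : Ω → ℝ} (hf : Measurable f) :
    Integrable (fun ω => stepReward a (f ω)) P := by
  refine Integrable.of_bound (C := 1) ((measurable_stepReward a).comp hf).aestronglyMeasurable
    (ae_of_all _ fun ω => ?_)
  have h := stepReward_mem_Icc ha (f ω)
  rw [Real.norm_eq_abs, abs_le]
  exact ⟨by linarith [h.1], h.2⟩

section

variable {δ σ r a b : ℝ} [hr : Fact (0 < r)] [ha : Fact (0 < a)] [hb : Fact (0 < b)]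

/-- The expected reward after one step, as an average over its upward part `v`. -/
lemma integral_stepReward_sub_stepLaw (hσ : σ ≠ 0)
    (hab : a * b * σ ^ 2 = 2 * r) (hba : (b - a) * σ ^ 2 = 2 * δ) (s : ℝ) :
    ∫ x, stepReward a (s - x) ∂(stepLaw δ σ r)
      = ∫ v, (1 - Real.exp (min (s + v) 0) * (a / (1 + a))) ∂(expMeasure b) := by
  have hm : Measurable fun x => stepReward a (s - x) :=
    (measurable_stepReward a).comp (by fun_prop)
  rw [stepLaw_eq_map_sub hσ hab hba, integral_map (by fun_prop) hm.aestronglyMeasurable,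
    integral_prod_symm _ (integrable_stepReward_comp ha.out (by fun_prop))]
  simp_rw [← integral_stepReward_sub_expMeasure]
  congr! 4
  ring_nf

/-- The constant `1 / (1 + a)` is consistent: it is reproduced by a step from any `s ≥ 0`. -/
lemma integral_stepReward_sub_stepLaw_of_nonneg (hσ : σ ≠ 0)
    (hab : a * b * σ ^ 2 = 2 * r) (hba : (b - a) * σ ^ 2 = 2 * δ) {s : ℝ} (hs : 0 ≤ s) :
    ∫ x, stepReward a (s - x) ∂(stepLaw δ σ r) = 1 / (1 + a) := by
  have ha := ha.out
  rw [integral_stepReward_sub_stepLaw hσ hab hba]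
  have : (fun v => 1 - Real.exp (min (s + v) 0) * (a / (1 + a)))
      =ᵐ[expMeasure b] fun _ => 1 / (1 + a) := by
    filter_upwards [ae_pos_expMeasure b] with v hv
    rw [min_eq_right (by positivity), Real.exp_zero]
    field_simp
    ring
  rw [integral_congr_ae this]
  simp

lemma le_integral_stepReward_sub_stepLaw (hσ : σ ≠ 0)
    (hab : a * b * σ ^ 2 = 2 * r) (hba : (b - a) * σ ^ 2 = 2 * δ) (s : ℝ) :
    1 / (1 + a) ≤ ∫ x, stepReward a (s - x) ∂(stepLaw δ σ r) := by
  have ha := ha.out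
  rw [integral_stepReward_sub_stepLaw hσ hab hba]
  have hle : ∀ v, Real.exp (min (s + v) 0) ≤ 1 := fun v =>
    Real.exp_le_one_iff.2 (min_le_right _ _)
  have hc : ∫ _ : ℝ, 1 / (1 + a) ∂(expMeasure b) = 1 / (1 + a) := by simp
  rw [← hc]
  refine integral_mono (integrable_const _) ?_ fun v => ?_
  · refine (integrable_const _).sub ((Integrable.of_bound (C := 1) (by fun_prop)
      (ae_of_all _ fun v => ?_)).mul_const _)
    simp [hle v]
  · have h1 := mul_le_mul_of_nonneg_right (hle v) (by positivity : 0 ≤ a / (1 + a))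
    have h2 : 1 / (1 + a) = 1 - 1 * (a / (1 + a)) := by field_simp; ring
    simp only
    linarith

/-- The upward drift of the step, in exponential form. The exponent `-δ / σ²` is where the Laplace
exponent `σ² x² / 2 + δ x` is smallest. -/
lemma lintegral_exp_stepLaw_lt_one (hσ : σ ≠ 0) (hδ : 0 < δ) :
    ∫⁻ x, ENNReal.ofReal (Real.exp (-(δ / σ ^ 2) * x)) ∂(stepLaw δ σ r) < 1 := by
  set k := δ ^ 2 / (2 * σ ^ 2) with hk
  have hkpos : 0 < k := by positivity
  have hr0 := hr.out
  rw [stepLaw, Measure.lintegral_bind (by fun_prop) (by fun_prop)]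
  have h : (fun e => ∫⁻ x, ENNReal.ofReal (Real.exp (-(δ / σ ^ 2) * x)) ∂(displacement δ σ e))
      =ᵐ[expMeasure r] fun e => ENNReal.ofReal (Real.exp (-k * e)) := by
    filter_upwards [ae_pos_expMeasure r] with e he
    change ∫⁻ x, _ ∂(gaussianReal (δ * e) (Real.toNNReal (σ ^ 2 * e))) = _
    rw [← ofReal_integral_eq_lintegral_ofReal (integrable_exp_mul_gaussianReal _)
      (ae_of_all _ fun _ => (Real.exp_pos _).le)]
    have := congrFun (mgf_id_gaussianReal (μ := δ * e) (v := Real.toNNReal (σ ^ 2 * e)))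
      (-(δ / σ ^ 2))
    simp only [mgf, id] at this
    rw [this, Real.coe_toNNReal _ (by positivity)]
    congr 2
    rw [hk]
    field_simp
    ring
  rw [lintegral_congr_ae h, ← ofReal_integral_eq_lintegral_ofReal,
    integral_exp_expMeasure hr0 (by linarith), ENNReal.ofReal_lt_one, div_lt_one (by linarith)]
  · linarith
  · refine Integrable.of_bound (C := 1) (by fun_prop) ?_
    filter_upwards [ae_pos_expMeasure r] with u hu
    simp
    positivity
  · exact ae_of_all _ fun _ => (Real.exp_pos _).le

end

/-! ### First passage of the random walk -/

/-- The walk `z - x 0 - ⋯ - x n`: its value at index `n` already includes `n + 1` steps. -/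
def walk (z : ℝ) (x : ℕ → ℝ) (n : ℕ) : ℝ := z - ∑ k ∈ Finset.range (n + 1), x k

lemma walk_zero (z : ℝ) (x : ℕ → ℝ) : walk z x 0 = z - x 0 := by simp [walk]

lemma walk_succ (z : ℝ) (x : ℕ → ℝ) (n : ℕ) : walk z x (n + 1) = walk z x n - x (n + 1) := by
  rw [walk, Finset.sum_range_succ, walk]
  ring

lemma measurable_walk (z : ℝ) (n : ℕ) : Measurable fun x : ℕ → ℝ => walk z x n := by
  unfold walk
  fun_prop

/-- The sequences of steps for which the first `n` values of the walk are positive. -/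
def survivors (z : ℝ) (n : ℕ) : Set (ℕ → ℝ) := {x | ∀ k < n, 0 < walk z x k}

lemma measurableSet_survivors (z : ℝ) (n : ℕ) : MeasurableSet (survivors z n) := by
  simp only [survivors, Set.ofPred_forall]
  exact MeasurableSet.iInter fun k => MeasurableSet.iInter fun _ =>
    measurableSet_lt measurable_const (measurable_walk z k)

lemma walk_congr {z : ℝ} {x y : ℕ → ℝ} {n : ℕ} (h : ∀ k ≤ n, x k = y k) :
    walk z x n = walk z y n := by
  unfold walk
  rw [Finset.sum_congr rfl fun k hk => h k (by simpa [Nat.lt_succ_iff] using hk)]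

section

variable {Ω : Type u} [MeasurableSpace Ω] {P : Measure Ω} {X : ℕ → Ω → ℝ} {ν : Measure ℝ}

/-- While the walk is positive, the expected reward of the next position, given the past, is the
constant `c`. -/
lemma integral_next_step [IsProbabilityMeasure ν] (hX : ∀ n, Measurable (X n))
    (hind : iIndepFun X P) (hlaw : ∀ n, P.map (X n) = ν) {a z c : ℝ} (ha : 0 < a)
    (hc : ∀ s, 0 ≤ s → ∫ x, stepReward a (s - x) ∂ν = c) (n : ℕ) :
    ∫ ω, (survivors z (n + 1)).indicator
      (fun x => stepReward a (walk z x (n + 1)) - c) (fun k => X k ω) ∂P = 0 := by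
  have := hind.isProbabilityMeasure
  -- the past, recorded as a sequence that vanishes after `n`
  set Y : Ω → ℕ → ℝ := fun ω k => if k ≤ n then X k ω else 0 with hY
  have hYm : Measurable Y := measurable_pi_lambda _ fun k => by
    by_cases hk : k ≤ n <;> simp [hY, hk, hX k]
  have hYX : IndepFun Y (X (n + 1)) P := by
    have h := hind.indepFun_finset (Finset.range (n + 1)) {n + 1} (by simp) hX
    refine h.comp (φ := fun y k => if hk : k ∈ Finset.range (n + 1) then y ⟨k, hk⟩ else 0)
      (ψ := fun y => y ⟨n + 1, by simp⟩) (measurable_pi_lambda _ fun k => ?_)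
      (measurable_pi_apply _)
      |>.congr (ae_of_all _ fun ω => ?_) (ae_of_all _ fun ω => rfl)
    · by_cases hk : k ∈ Finset.range (n + 1)
      · simp only [hk, dif_pos]
        fun_prop
      · simp only [hk, dif_neg, not_false_eq_true]
        fun_prop
    · funext k
      by_cases hk : k ≤ n
      · simp [hY, hk]
      · simp [hY, hk]
  set F : (ℕ → ℝ) × ℝ → ℝ := fun p => (survivors z (n + 1)).indicator
      (fun y => stepReward a (walk z y n - p.2) - c) p.1 with hF
  have hFm : Measurable F := by
    have h : F = (Prod.fst ⁻¹' survivors z (n + 1)).indicator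
        fun p : (ℕ → ℝ) × ℝ => stepReward a (walk z p.1 n - p.2) - c := by
      funext p
      simp only [hF, Set.indicator]
      rfl
    rw [h]
    exact (((measurable_stepReward a).comp (((measurable_walk z n).comp measurable_fst).sub
      measurable_snd)).sub_const c).indicator ((measurableSet_survivors z (n + 1)).preimage
        measurable_fst)
  have hFb : ∀ p, ‖F p‖ ≤ 1 + |c| := fun p => by
    refine (norm_indicator_le_norm_self _ _).trans ?_
    have h := stepReward_mem_Icc ha (walk z p.1 n - p.2)
    refine (norm_sub_le _ _).trans (add_le_add ?_ le_rfl)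
    rw [Real.norm_eq_abs, abs_of_nonneg h.1]
    exact h.2
  have hwalk : ∀ ω, ∀ k ≤ n, walk z (Y ω) k = walk z (fun k => X k ω) k := fun ω k hk =>
    walk_congr fun j hj => by simp [hY, hj.trans hk]
  have hmem : ∀ ω, Y ω ∈ survivors z (n + 1) ↔ (fun k => X k ω) ∈ survivors z (n + 1) :=
    fun ω => forall₂_congr fun k hk => by rw [hwalk ω k (Nat.lt_succ_iff.1 hk)]
  have h1 : ∀ ω, (survivors z (n + 1)).indicator
      (fun x => stepReward a (walk z x (n + 1)) - c) (fun k => X k ω) = F (Y ω, X (n + 1) ω) := by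
    intro ω
    by_cases h : (fun k => X k ω) ∈ survivors z (n + 1)
    · simp only [hF, Set.indicator_of_mem h, Set.indicator_of_mem ((hmem ω).2 h),
        hwalk ω n le_rfl, walk_succ]
    · simp only [hF, Set.indicator_of_notMem h, Set.indicator_of_notMem (mt (hmem ω).1 h)]
  have : IsProbabilityMeasure (P.map Y) := Measure.isProbabilityMeasure_map hYm.aemeasurable
  simp_rw [h1]
  rw [← integral_map (φ := fun ω => (Y ω, X (n + 1) ω)) (by fun_prop) hFm.aestronglyMeasurable,
    hYX.map_prod_eq_prod_map_map hYm.aemeasurable (hX _).aemeasurable, hlaw,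
    integral_prod _ (Integrable.of_bound hFm.aestronglyMeasurable (1 + |c|) (ae_of_all _ hFb))]
  refine integral_eq_zero_of_ae (ae_of_all _ fun y => ?_)
  by_cases hy : y ∈ survivors z (n + 1)
  · simp only [hF, Set.indicator, hy, if_true]
    rw [integral_sub (integrable_stepReward_comp ha (by fun_prop)) (integrable_const _),
      hc _ (hy n (Nat.lt_succ_self n)).le]
    simp
  · simp [hF, hy]

/-- The expected loss at the first passage below zero equals the expected reward after the first
step: the reward of the walk stopped at its first passage is a bounded martingale. -/
lemma integral_reward_at_first_passage [IsProbabilityMeasure ν] (hX : ∀ n, Measurable (X n))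
    (hind : iIndepFun X P) (hlaw : ∀ n, P.map (X n) = ν) {a z : ℝ} (ha : 0 < a)
    (hc : ∀ s, 0 ≤ s → ∫ x, stepReward a (s - x) ∂ν = 1 / (1 + a))
    (hex : ∀ᵐ ω ∂P, ∃ n, walk z (fun k => X k ω) n ≤ 0) {R : Ω → ℝ}
    (hR : ∀ᵐ ω ∂P, ∀ n, (fun k => X k ω) ∈ survivors z n → walk z (fun k => X k ω) n ≤ 0 →
      R ω = 1 - Real.exp (walk z (fun k => X k ω) n)) :
    Integrable R P ∧ ∫ ω, R ω ∂P = ∫ x, stepReward a (z - x) ∂ν := by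
  have := hind.isProbabilityMeasure
  set c := 1 / (1 + a) with hcdef
  set D : ℕ → Ω → ℝ := fun n ω => (survivors z (n + 1)).indicator
      (fun x => stepReward a (walk z x (n + 1)) - c) (fun k => X k ω) with hD
  set V : ℕ → Ω → ℝ := fun n ω =>
    stepReward a (walk z (fun k => X k ω) 0) + ∑ k ∈ Finset.range n, D k ω with hV
  have hXm : Measurable fun ω k => X k ω := measurable_pi_lambda _ hX
  have hDm : ∀ n, Measurable (D n) := fun n =>
    ((((measurable_stepReward a).comp (measurable_walk z (n + 1))).sub_const c).indicator
      (measurableSet_survivors z (n + 1))).comp hXm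
  have hVm : ∀ n, Measurable (V n) := fun n =>
    ((measurable_stepReward a).comp ((measurable_walk z 0).comp hXm)).add
      (Finset.measurable_sum _ fun k _ => hDm k)
  have hV_succ : ∀ n ω, V (n + 1) ω = V n ω + D n ω := fun n ω => by
    simp only [hV, Finset.sum_range_succ, add_assoc]
  have hpos : ∀ s : ℝ, 0 < s → stepReward a s = c := fun s hs => by
    rw [stepReward, if_neg hs.not_ge]
  -- `V n` is the reward of the walk stopped at time `n` or at its first passage.
  have key : ∀ ω n, ((fun k => X k ω) ∈ survivors z (n + 1) ∧ V n ω = c) ∨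
      ∃ m ≤ n, (fun k => X k ω) ∈ survivors z m ∧ walk z (fun k => X k ω) m ≤ 0 ∧
        V n ω = stepReward a (walk z (fun k => X k ω) m) := by
    intro ω n
    induction n with
    | zero =>
      rcases le_or_gt (walk z (fun k => X k ω) 0) 0 with h | h
      · exact Or.inr ⟨0, le_rfl, fun k hk => absurd hk (by simp), h, by simp [hV]⟩
      · refine Or.inl ⟨fun k hk => ?_, by simp [hV, hpos _ h]⟩
        rwa [Nat.lt_one_iff.1 hk]
    | succ n ih =>
      rw [hV_succ]
      rcases ih with ⟨hs, hVc⟩ | ⟨m, hmn, hs, hm, hVm⟩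
      · have hDn : D n ω = stepReward a (walk z (fun k => X k ω) (n + 1)) - c := by
          simp only [hD, Set.indicator_of_mem hs]
        rw [hDn, hVc]
        rcases le_or_gt (walk z (fun k => X k ω) (n + 1)) 0 with h | h
        · exact Or.inr ⟨n + 1, le_rfl, hs, h, by ring⟩
        · refine Or.inl ⟨fun k hk => ?_, by rw [hpos _ h]; ring⟩
          rcases Nat.lt_succ_iff_lt_or_eq.1 hk with hk | rfl
          · exact hs k hk
          · exact h
      · refine Or.inr ⟨m, hmn.trans n.le_succ, hs, hm, ?_⟩
        have : D n ω = 0 := Set.indicator_of_notMem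
          (fun h => (h m (Nat.lt_succ_of_le hmn)).not_ge hm) _
        rw [this, hVm, add_zero]
  have hVb : ∀ n ω, ‖V n ω‖ ≤ 1 := fun n ω => by
    have hI : V n ω ∈ Set.Icc (0 : ℝ) 1 := by
      rcases key ω n with ⟨-, h⟩ | ⟨m, -, -, -, h⟩
      · rw [h, ← hpos 1 one_pos]
        exact stepReward_mem_Icc ha _
      · rw [h]
        exact stepReward_mem_Icc ha _
    rw [Real.norm_eq_abs, abs_of_nonneg hI.1]
    exact hI.2
  have hlim : ∀ᵐ ω ∂P, Tendsto (fun n => V n ω) atTop (𝓝 (R ω)) := by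
    filter_upwards [hex, hR] with ω ⟨N, hN⟩ hRω
    refine tendsto_const_nhds.congr' ?_
    filter_upwards [eventually_ge_atTop N] with n hn
    rcases key ω n with ⟨h, -⟩ | ⟨m, -, hs, hm, h⟩
    · exact absurd (h N (Nat.lt_succ_of_le hn)) hN.not_gt
    · rw [h, hRω m hs hm, stepReward, if_pos hm]
  have hDi : ∀ n, Integrable (D n) P := fun n => by
    have : D n = fun ω => V (n + 1) ω - V n ω := by
      funext ω
      rw [hV_succ]
      ring
    rw [this]
    exact (Integrable.of_bound (hVm _).aestronglyMeasurable 1 (ae_of_all _ (hVb _))).sub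
      (Integrable.of_bound (hVm _).aestronglyMeasurable 1 (ae_of_all _ (hVb _)))
  have hVint : ∀ n, ∫ ω, V n ω ∂P = ∫ x, stepReward a (z - x) ∂ν := by
    intro n
    have h0 : Integrable (fun ω => stepReward a (walk z (fun k => X k ω) 0)) P :=
      integrable_stepReward_comp ha ((measurable_walk z 0).comp hXm)
    have hm : Measurable fun x => stepReward a (z - x) :=
      (measurable_stepReward a).comp (by fun_prop)
    simp only [hV]
    rw [integral_add h0 (integrable_finsetSum _ fun k _ => hDi k),
      integral_finsetSum _ fun k _ => hDi k,
      Finset.sum_eq_zero fun k _ => integral_next_step hX hind hlaw ha hc k, add_zero,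
      ← hlaw 0, integral_map (hX 0).aemeasurable hm.aestronglyMeasurable]
    simp_rw [walk_zero]
  have hRm : AEStronglyMeasurable R P :=
    aestronglyMeasurable_of_tendsto_ae atTop (fun n => (hVm n).aestronglyMeasurable) hlim
  refine ⟨Integrable.of_bound hRm 1 ?_, ?_⟩
  · filter_upwards [hlim] with ω h
    exact le_of_tendsto h.norm (Eventually.of_forall fun n => hVb n ω)
  · have h := tendsto_integral_of_dominated_convergence (fun _ => (1 : ℝ))
      (fun n => (hVm n).aestronglyMeasurable) (integrable_const _)
      (fun n => ae_of_all _ (hVb n)) hlim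
    simp_rw [hVint] at h
    exact tendsto_nhds_unique h tendsto_const_nhds

/-- If the subtracted steps drift upward in the sense that `E[exp (-s x)] < 1`, the walk reaches the
negative half-line: by Markov's inequality it is positive at time `n` with a probability that decays
geometrically. -/
lemma ae_exists_walk_nonpos (hX : ∀ n, Measurable (X n))
    (hind : iIndepFun X P) (hlaw : ∀ n, P.map (X n) = ν) {s : ℝ} (hs : 0 < s)
    (hν : ∫⁻ x, ENNReal.ofReal (Real.exp (-s * x)) ∂ν < 1) (z : ℝ) :
    ∀ᵐ ω ∂P, ∃ n, walk z (fun k => X k ω) n ≤ 0 := by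
  set q := ∫⁻ x, ENNReal.ofReal (Real.exp (-s * x)) ∂ν with hq
  have hbound : ∀ n, P {ω | ¬ ∃ n, walk z (fun k => X k ω) n ≤ 0}
      ≤ ENNReal.ofReal (Real.exp (s * z)) * q ^ (n + 1) := by
    intro n
    have hint : ∫⁻ ω, ENNReal.ofReal (Real.exp (s * walk z (fun k => X k ω) n)) ∂P
        = ENNReal.ofReal (Real.exp (s * z)) * q ^ (n + 1) := by
      have h : ∀ ω, ENNReal.ofReal (Real.exp (s * walk z (fun k => X k ω) n))
          = ENNReal.ofReal (Real.exp (s * z)) *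
            ∏ k ∈ Finset.range (n + 1), ENNReal.ofReal (Real.exp (-s * X k ω)) := fun ω => by
        rw [← ENNReal.ofReal_prod_of_nonneg fun _ _ => (Real.exp_pos _).le,
          ← Real.exp_sum, ← ENNReal.ofReal_mul (Real.exp_pos _).le, ← Real.exp_add,
          ← Finset.mul_sum, walk]
        ring_nf
      simp_rw [h]
      have hm : ∀ k, Measurable fun ω => ENNReal.ofReal (Real.exp (-s * X k ω)) := fun k => by
        have := hX k
        fun_prop
      rw [lintegral_const_mul _ (Finset.measurable_prod _ fun k _ => hm k),
        lintegral_prod_eq_prod_lintegral_of_indepFun _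
          (fun k ω => ENNReal.ofReal (Real.exp (-s * X k ω)))
          (hind.comp (fun _ x => ENNReal.ofReal (Real.exp (-s * x))) fun _ => by fun_prop) hm]
      congr 1
      rw [Finset.prod_congr rfl (g := fun _ => q) fun k _ => ?_, Finset.prod_const,
        Finset.card_range]
      rw [hq, ← hlaw k, lintegral_map (by fun_prop) (hX k)]
    have hm : Measurable fun ω =>
        ENNReal.ofReal (Real.exp (s * walk z (fun k => X k ω) n)) := by
      have := (measurable_walk z n).comp (measurable_pi_lambda _ hX)
      exact ((this.const_mul s).exp).ennreal_ofReal
    rw [← hint]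
    refine le_trans (measure_mono fun ω hω => ?_)
      (by simpa using mul_meas_ge_le_lintegral (μ := P) hm 1)
    have h : 0 < walk z (fun k => X k ω) n := not_le.1 fun h => hω ⟨n, h⟩
    exact (mul_pos hs h).le
  have hlim : Tendsto (fun n : ℕ => ENNReal.ofReal (Real.exp (s * z)) * q ^ (n + 1)) atTop
      (𝓝 0) := by
    have h := ENNReal.Tendsto.const_mul ((tendsto_add_atTop_iff_nat 1).2
      (ENNReal.tendsto_pow_atTop_nhds_zero_of_lt_one hν))
      (Or.inr (ENNReal.ofReal_ne_top (r := Real.exp (s * z))))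
    simpa using h
  rw [ae_iff]
  exact le_antisymm (ge_of_tendsto' hlim hbound) zero_le

end

/-! ### Brownian motion sampled at independent renewal times -/

section
variable {Ω : Type u} [MeasurableSpace Ω] {P : Measure Ω}

/-- The version vanishes on a measurable null set containing every discontinuous path of `W`, and is
`W` elsewhere. Values at a countable dense set of times can be made measurable by enlarging the null
set, and values at other times are limits of these. -/
lemma exists_continuous_measurable_version {W : ℝ≥0 → Ω → ℝ} (hm : ∀ t, AEMeasurable (W t) P)
    (hc : ∀ᵐ ω ∂P, Continuous (W · ω)) :
    ∃ W' : ℝ≥0 → Ω → ℝ, (∀ ω, Continuous (W' · ω)) ∧ (∀ t, Measurable (W' t)) ∧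
      ∀ᵐ ω ∂P, ∀ t, W t ω = W' t ω := by
  obtain ⟨D, hDc, hDd⟩ := TopologicalSpace.exists_countable_dense ℝ≥0
  have hgood : ∀ᵐ ω ∂P, Continuous (W · ω) ∧ ∀ q ∈ D, W q ω = (hm q).mk _ ω :=
    hc.and ((ae_ball_iff hDc).2 fun q _ => (hm q).ae_eq_mk)
  obtain ⟨G, hGsub, hGm, hGnull⟩ := exists_measurable_superset_of_null (ae_iff.1 hgood)
  have hG : ∀ ω ∉ G, Continuous (W · ω) ∧ ∀ q ∈ D, W q ω = (hm q).mk _ ω := fun ω hω => by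
    by_contra h
    exact hω (hGsub h)
  refine ⟨fun t => Gᶜ.indicator (W t), fun ω => ?_, fun t => ?_, ?_⟩
  · by_cases hω : ω ∈ G
    · simp only [Set.indicator_of_notMem (fun h : ω ∈ Gᶜ => h hω)]
      exact continuous_const
    · simp only [Set.indicator_of_mem (show ω ∈ Gᶜ from hω)]
      exact (hG ω hω).1
  · obtain ⟨q, hqD, hqt⟩ := mem_closure_iff_seq_limit.1 (hDd t)
    refine measurable_of_tendsto_metrizable
      (f := fun n => Gᶜ.indicator ((hm (q n)).mk _)) (fun n =>
        (hm (q n)).measurable_mk.indicator hGm.compl) (tendsto_pi_nhds.2 fun ω => ?_)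
    by_cases hω : ω ∈ G
    · simp only [Set.indicator_of_notMem (fun h : ω ∈ Gᶜ => h hω)]
      exact tendsto_const_nhds
    · simp only [Set.indicator_of_mem (show ω ∈ Gᶜ from hω), ← (hG ω hω).2 _ (hqD _)]
      exact ((hG ω hω).1.tendsto t).comp hqt
  · have : ∀ᵐ ω ∂P, ω ∉ G := measure_eq_zero_iff_ae_notMem.1 hGnull
    filter_upwards [this] with ω hω t
    exact (Set.indicator_of_mem (show ω ∈ Gᶜ from hω) _).symm

/-- The space of continuous paths, with the σ-algebra generated by the evaluations; unlike on the
space of all paths, the evaluation is jointly measurable in the path and the time. -/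
abbrev ContPath := {w : ℝ≥0 → ℝ // Continuous w}

lemma measurable_eval_contPath : Measurable fun p : ContPath × ℝ≥0 => p.1.1 p.2 := by
  have h : Measurable (Function.uncurry fun (t : ℝ≥0) (w : ContPath) => w.1 t) :=
    measurable_uncurry_of_continuous_of_measurable (fun w => w.2)
      (fun t => (measurable_pi_apply t).comp measurable_subtype_coe)
  exact h.comp measurable_swap

/-- The displacement of `s ↦ δ s + σ w s` between the times `t k` and `t (k + 1)`. -/
def increment (δ σ : ℝ) (w : ℝ≥0 → ℝ) (t : ℕ → ℝ≥0) (k : ℕ) : ℝ :=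
  δ * ((t (k + 1) : ℝ) - t k) + σ * (w (t (k + 1)) - w (t k))

lemma measurable_increment (δ σ : ℝ) (k : ℕ) :
    Measurable fun p : ContPath × (ℕ → ℝ≥0) => increment δ σ p.1.1 p.2 k := by
  have h : ∀ j, Measurable fun p : ContPath × (ℕ → ℝ≥0) => p.1.1 (p.2 j) := fun j =>
    measurable_eval_contPath.comp
      (measurable_fst.prodMk ((measurable_pi_apply j).comp measurable_snd))
  have h1 := h (k + 1)
  have h2 := h k
  unfold increment
  fun_prop

lemma measure_inter_increment {W : ℝ≥0 → Ω → ℝ} (hW : IsPreBrownianReal W P)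
    (δ σ : ℝ) {t : ℕ → ℝ≥0} (ht : Monotone t) (S : Finset ℕ) {A : ℕ → Set ℝ}
    (hA : ∀ k ∈ S, MeasurableSet (A k)) :
    P (⋂ k ∈ S, (fun ω => increment δ σ (W · ω) t k) ⁻¹' A k)
      = ∏ k ∈ S, displacement δ σ ((t (k + 1) : ℝ) - t k) (A k) := by
  have hind : iIndepFun (fun k ω => increment δ σ (W · ω) t k) P :=
    (hW.hasIndepIncrements.nat ht).comp
      (fun k x => δ * ((t (k + 1) : ℝ) - t k) + σ * x) fun k => by fun_prop
  rw [hind.measure_inter_preimage_eq_mul S hA]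
  refine Finset.prod_congr rfl fun k hk => ?_
  have hle : (t k : ℝ) ≤ t (k + 1) := by exact_mod_cast ht k.le_succ
  have h := gaussianReal_const_add (gaussianReal_const_mul (hW.hasLaw_sub (t (k + 1)) (t k)) σ)
    (δ * ((t (k + 1) : ℝ) - t k))
  have h' : P.map (fun ω => increment δ σ (W · ω) t k)
      = gaussianReal (δ * ((t (k + 1) : ℝ) - t k))
        (Real.toNNReal (σ ^ 2 * ((t (k + 1) : ℝ) - t k))) := by
    refine Eq.trans h.map_eq ?_
    congr 1
    · ring
    · ext
      rw [Real.coe_toNNReal _ (mul_nonneg (sq_nonneg _) (sub_nonneg.2 hle))]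
      simp [Real.dist_eq, abs_of_nonneg (sub_nonneg.2 hle)]
  have hm : AEMeasurable (fun ω => increment δ σ (W · ω) t k) P := by
    have h1 := hW.aemeasurable (t (k + 1))
    have h2 := hW.aemeasurable (t k)
    unfold increment
    fun_prop
  rw [← Measure.map_apply_of_aemeasurable hm (hA k hk), h']
  rfl

/-- Conditionally on the times `τ`, the increments are independent Gaussians whose laws depend only
on the gaps between the times. As these gaps are independent, integrating them out preserves the
product form. -/
lemma measure_inter_increment_random [IsProbabilityMeasure P] {W : ℝ≥0 → Ω → ℝ}
    (hW : IsPreBrownianReal W P)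
    (hWc : ∀ ω, Continuous (W · ω)) (hWm : ∀ t, Measurable (W t))
    {τ : ℕ → Ω → ℝ≥0} (hτm : ∀ n, Measurable (τ n)) (hτ : ∀ᵐ ω ∂P, Monotone (τ · ω))
    (hWτ : IndepFun (fun ω t => W t ω) (fun ω n => τ n ω) P) {r : ℝ}
    (hlaw : ∀ n, P.map (fun ω => (τ (n + 1) ω : ℝ) - τ n ω) = expMeasure r)
    (hind : iIndepFun (fun n ω => (τ (n + 1) ω : ℝ) - τ n ω) P)
    (δ σ : ℝ) (S : Finset ℕ) {A : ℕ → Set ℝ} (hA : ∀ k, MeasurableSet (A k)) :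
    P (⋂ k ∈ S, (fun ω => increment δ σ (W · ω) (τ · ω) k) ⁻¹' A k)
      = ∏ k ∈ S, stepLaw δ σ r (A k) := by
  set f : Ω → ContPath := fun ω => ⟨fun t => W t ω, hWc ω⟩ with hf
  have hfm : Measurable f := Measurable.subtype_mk (measurable_pi_lambda _ hWm)
  have hτm' : Measurable fun ω n => τ n ω := measurable_pi_lambda _ hτm
  have hfτ : IndepFun f (fun ω n => τ n ω) P := by
    rw [IndepFun_iff_Indep] at hWτ ⊢
    have : MeasurableSpace.comap f inferInstance
        = MeasurableSpace.comap (fun ω t => W t ω) inferInstance :=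
      MeasurableSpace.comap_comp
    rwa [this]
  set E : Set (ContPath × (ℕ → ℝ≥0)) :=
    ⋂ k ∈ S, (fun p => increment δ σ p.1.1 p.2 k) ⁻¹' A k with hE
  have hEm : MeasurableSet E :=
    Finset.measurableSet_biInter _ fun k _ => measurable_increment δ σ k (hA k)
  have hpre : (⋂ k ∈ S, (fun ω => increment δ σ (W · ω) (τ · ω) k) ⁻¹' A k)
      = (fun ω => (f ω, fun n => τ n ω)) ⁻¹' E := by
    ext ω
    simp [hE, hf]
  have hgm : ∀ k, Measurable fun ω => (τ (k + 1) ω : ℝ) - τ k ω := fun k => by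
    have h1 := hτm (k + 1)
    have h2 := hτm k
    fun_prop
  have := Measure.isProbabilityMeasure_map (μ := P) hfm.aemeasurable
  have := Measure.isProbabilityMeasure_map (μ := P) hτm'.aemeasurable
  rw [hpre, ← Measure.map_apply (hfm.prodMk hτm') hEm,
    hfτ.map_prod_eq_prod_map_map hfm.aemeasurable hτm'.aemeasurable,
    Measure.prod_apply_symm hEm, lintegral_map (measurable_measure_prodMk_right hEm) hτm']
  have hslice : ∀ᵐ ω ∂P, P.map f ((fun w => (w, fun n => τ n ω)) ⁻¹' E)
      = ∏ k ∈ S, displacement δ σ ((τ (k + 1) ω : ℝ) - τ k ω) (A k) := by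
    filter_upwards [hτ] with ω hω
    rw [Measure.map_apply hfm (hEm.preimage (by fun_prop)),
      ← measure_inter_increment hW δ σ hω S fun k _ => hA k]
    congr 1
    ext ω'
    simp [hE, hf]
  rw [lintegral_congr_ae hslice]
  have hm : ∀ k, Measurable fun e => displacement δ σ e (A k) := fun k =>
    Kernel.measurable_coe _ (hA k)
  rw [lintegral_prod_eq_prod_lintegral_of_indepFun S
    (fun k ω => displacement δ σ ((τ (k + 1) ω : ℝ) - τ k ω) (A k))
    (hind.comp (fun k e => displacement δ σ e (A k)) hm) fun k => (hm k).comp (hgm k)]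
  refine Finset.prod_congr rfl fun k _ => ?_
  rw [stepLaw, Measure.bind_apply (hA k) (Kernel.aemeasurable _), ← hlaw k,
    lintegral_map (hm k) (hgm k)]

lemma map_increment_random_and_iIndepFun [IsProbabilityMeasure P] {W : ℝ≥0 → Ω → ℝ}
    (hW : IsPreBrownianReal W P)
    (hWc : ∀ ω, Continuous (W · ω)) (hWm : ∀ t, Measurable (W t))
    {τ : ℕ → Ω → ℝ≥0} (hτm : ∀ n, Measurable (τ n)) (hτ : ∀ᵐ ω ∂P, Monotone (τ · ω))
    (hWτ : IndepFun (fun ω t => W t ω) (fun ω n => τ n ω) P) {r : ℝ}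
    (hlaw : ∀ n, P.map (fun ω => (τ (n + 1) ω : ℝ) - τ n ω) = expMeasure r)
    (hind : iIndepFun (fun n ω => (τ (n + 1) ω : ℝ) - τ n ω) P) (δ σ : ℝ) :
    (∀ k, Measurable fun ω => increment δ σ (W · ω) (τ · ω) k) ∧
    (∀ k, P.map (fun ω => increment δ σ (W · ω) (τ · ω) k) = stepLaw δ σ r) ∧
      iIndepFun (fun k ω => increment δ σ (W · ω) (τ · ω) k) P := by
  have hm : ∀ k, Measurable fun ω => increment δ σ (W · ω) (τ · ω) k := fun k =>
    (measurable_increment δ σ k).comp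
      (f := fun ω => ((⟨fun t => W t ω, hWc ω⟩, fun n => τ n ω) : ContPath × (ℕ → ℝ≥0)))
      ((Measurable.subtype_mk (measurable_pi_lambda _ hWm)).prodMk (measurable_pi_lambda _ hτm))
  have h : ∀ (S : Finset ℕ) {A : ℕ → Set ℝ}, (∀ k, MeasurableSet (A k)) →
      P (⋂ k ∈ S, (fun ω => increment δ σ (W · ω) (τ · ω) k) ⁻¹' A k)
        = ∏ k ∈ S, stepLaw δ σ r (A k) := fun S _ hA =>
    measure_inter_increment_random hW hWc hWm hτm hτ hWτ hlaw hind δ σ S hA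
  have h1 : ∀ k {A : Set ℝ}, MeasurableSet A →
      P ((fun ω => increment δ σ (W · ω) (τ · ω) k) ⁻¹' A) = stepLaw δ σ r A := fun k A hA => by
    simpa using h {k} (A := fun _ => A) fun _ => hA
  refine ⟨hm, fun k => Measure.ext fun A hA => ?_,
    iIndepFun_iff_measure_inter_preimage_eq_mul.2 fun S A hA => ?_⟩
  · rw [Measure.map_apply (hm k) hA, h1 k hA]
  · have h2 := h S (A := fun k => if k ∈ S then A k else Set.univ) fun k => by
      split_ifs with hk
      · exact hA k hk
      · exact MeasurableSet.univ
    convert h2 using 1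
    · congr 1
      refine Set.iInter₂_congr fun k hk => ?_
      rw [if_pos hk]
    · refine Finset.prod_congr rfl fun k hk => ?_
      rw [if_pos hk, h1 k (hA k hk)]

end

/-! ### The mispricing at the block times -/

section
variable {Ω : Type u}

/-- The arrival times `T`, preceded by the initial time `0`. -/
def blockTime (T : ℕ → Ω → ℝ≥0) : ℕ → Ω → ℝ≥0
  | 0, _ => 0
  | n + 1, ω => T n ω

lemma interarrival_eq (T : ℕ → Ω → ℝ≥0) (n : ℕ) (ω : Ω) :
    interarrival T n ω = (blockTime T (n + 1) ω : ℝ) - blockTime T n ω := by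
  cases n <;> simp [interarrival, blockTime]

lemma walk_increment_blockTime {δ σ z : ℝ} (w : ℝ≥0 → ℝ) (T : ℕ → Ω → ℝ≥0) (ω : Ω) (n : ℕ) :
    walk z (increment δ σ w (blockTime T · ω)) n = z - δ * T n ω - σ * (w (T n ω) - w 0) := by
  induction n with
  | zero =>
    simp [walk_zero, increment, blockTime]
    ring
  | succ n ih =>
    rw [walk_succ, ih]
    simp only [increment, blockTime]
    ring

lemma mispricing_eq {A₀ lam P₀ μ σ : ℝ} (hA : 0 < A₀) (hP : 0 < P₀) (W : ℝ≥0 → Ω → ℝ)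
    (t : ℝ≥0) (ω : Ω) :
    mispricing A₀ lam P₀ μ σ W t ω
      = Real.log (A₀ / P₀) - (lam + μ - σ ^ 2 / 2) * t - σ * W t ω := by
  rw [mispricing, ask, price, mul_div_mul_comm, ← Real.exp_sub,
    Real.log_mul (div_pos hA hP).ne' (Real.exp_pos _).ne', Real.log_exp]
  ring

lemma isLeast_fillable {z : ℝ≥0 → Ω → ℝ} {T : ℕ → Ω → ℝ≥0} {ω : Ω} (hT : Monotone (T · ω))
    {n : ℕ} (hpos : ∀ k < n, 0 < z (T k ω) ω) (hn : z (T n ω) ω ≤ 0) :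
    IsLeast (fillable z T ω) (T n ω) := by
  refine ⟨⟨⟨n, rfl⟩, hn⟩, ?_⟩
  rintro t ⟨⟨k, rfl⟩, hk⟩
  exact hT (not_lt.1 fun h => (hpos k h).not_ge hk)

end

section
variable {Ω : Type u} [MeasurableSpace Ω] {P : Measure Ω} {T T' : ℕ → Ω → ℝ≥0} {r : ℝ}

lemma IsPoissonArrivals.aemeasurable (h : IsPoissonArrivals T r P) (n : ℕ) :
    AEMeasurable (T n) P := by
  have hreal : AEMeasurable (fun ω => (T n ω : ℝ)) P := by
    induction n with
    | zero => exact (h.hasLaw 0).aemeasurable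
    | succ n ih =>
      refine ((h.hasLaw (n + 1)).aemeasurable.add ih).congr (ae_of_all _ fun ω => ?_)
      simp [interarrival]
  simpa using hreal.real_toNNReal

lemma IsPoissonArrivals.congr (h : IsPoissonArrivals T r P) (hT : ∀ n, T n =ᵐ[P] T' n) :
    IsPoissonArrivals T' r P := by
  have hgap : ∀ n, interarrival T n =ᵐ[P] interarrival T' n := fun n => by
    filter_upwards [ae_all_iff.2 hT] with ω hω
    cases n <;> simp [interarrival, hω]
  exact ⟨fun n => (h.hasLaw n).congr (hgap n).symm, h.indep.congr hgap⟩

lemma IsPoissonArrivals.ae_monotone_blockTime (h : IsPoissonArrivals T r P) :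
    ∀ᵐ ω ∂P, Monotone (blockTime T · ω) := by
  have hpos : ∀ n, ∀ᵐ ω ∂P, 0 < interarrival T n ω := fun n =>
    ae_of_ae_map (h.hasLaw n).aemeasurable ((h.hasLaw n).map_eq ▸ ae_pos_expMeasure r)
  filter_upwards [ae_all_iff.2 hpos] with ω hω
  refine monotone_nat_of_le_succ fun n => ?_
  have := hω n
  rw [interarrival_eq, sub_pos] at this
  exact_mod_cast this.le

end

section

variable {Ω : Type u} [MeasurableSpace Ω] {P : Measure Ω} [IsProbabilityMeasure P]

/-- The log mispricing at successive blocks is a walk with independent steps of law `stepLaw`. -/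
lemma exists_iid_steps {W : ℝ≥0 → Ω → ℝ} {T : ℕ → Ω → ℝ≥0} {r : ℝ}
    (hW : IsBrownianReal W P) (hT : IsPoissonArrivals T r P)
    (hWT : IndepFun (fun ω t => W t ω) (fun ω n => T n ω) P) (δ σ : ℝ) :
    ∃ X : ℕ → Ω → ℝ, (∀ n, Measurable (X n)) ∧ (∀ n, P.map (X n) = stepLaw δ σ r) ∧
      iIndepFun X P ∧ ∀ᵐ ω ∂P, ∀ z n,
        walk z (fun k => X k ω) n = z - δ * T n ω - σ * W (T n ω) ω := by
  obtain ⟨W', hWc, hWm, hWW⟩ := exists_continuous_measurable_version hW.aemeasurable hW.cont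
  set T' : ℕ → Ω → ℝ≥0 := fun n => (hT.aemeasurable n).mk (T n) with hT'
  have hTT : ∀ n, T n =ᵐ[P] T' n := fun n => (hT.aemeasurable n).ae_eq_mk
  have hT'P := hT.congr hTT
  have hWP : IsPreBrownianReal W' P :=
    hW.toIsPreBrownianReal.congr fun t => hWW.mono fun ω h => h t
  have hτm : ∀ n, Measurable (blockTime T' n) := fun n => by
    cases n with
    | zero => exact measurable_const
    | succ n => exact (hT.aemeasurable n).measurable_mk
  have hind : IndepFun (fun ω t => W' t ω) (fun ω n => blockTime T' n ω) P := by
    have h := hWT.congr (hWW.mono fun ω h => funext h)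
      ((ae_all_iff.2 hTT).mono fun ω h => funext h)
    refine h.comp (φ := id) (ψ := fun t n => Nat.casesOn n 0 t) measurable_id
      (measurable_pi_lambda _ fun n => ?_) |>.congr (ae_of_all _ fun ω => rfl)
      (ae_of_all _ fun ω => ?_)
    · cases n with
      | zero => exact measurable_const
      | succ n => exact measurable_pi_apply n
    · funext n
      cases n <;> rfl
  have hgap : interarrival T' = fun n ω => (blockTime T' (n + 1) ω : ℝ) - blockTime T' n ω :=
    funext₂ (interarrival_eq T')
  obtain ⟨hm, hlaw, hiid⟩ := map_increment_random_and_iIndepFun hWP hWc hWm hτm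
    hT'P.ae_monotone_blockTime hind (fun n => hgap ▸ (hT'P.hasLaw n).map_eq) (hgap ▸ hT'P.indep)
    δ σ
  refine ⟨_, hm, hlaw, hiid, ?_⟩
  filter_upwards [hWW, ae_all_iff.2 hTT, hWP.eval_zero_ae_eq_zero] with ω hωW hωT hω0 z n
  have h := walk_increment_blockTime (δ := δ) (σ := σ) (z := z) (W' · ω) T' ω n
  rw [hω0, sub_zero, ← hωT, ← hωW] at h
  exact h

/-- The auction statements: the order is filled almost surely, and its expected loss is the expected
reward after one step, which is compared with `1 / (1 + a)`. -/
lemma fillTime_and_LVF_spec {σ Δt : ℝ} (hσ : 0 < σ) (hΔ : 0 < Δt)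
    {W : ℝ≥0 → Ω → ℝ} {T : ℕ → Ω → ℝ≥0} (hW : IsBrownianReal W P)
    (hT : IsPoissonArrivals T (1 / Δt) P)
    (hWT : IndepFun (fun ω t => W t ω) (fun ω n => T n ω) P) {A₀ lam P₀ μ δ : ℝ}
    (hA : 0 < A₀) (hP : 0 < P₀) (hδ : 0 < δ) (hδ' : δ = lam + μ - σ ^ 2 / 2) :
    (∀ᵐ ω ∂P, IsLeast (fillable (mispricing A₀ lam P₀ μ σ W) T ω)
      (fillTime (mispricing A₀ lam P₀ μ σ W) T ω)) ∧
    Integrable (relativeLoss (mispricing A₀ lam P₀ μ σ W) T) P ∧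
    (0 ≤ Real.log (A₀ / P₀) → LVF (mispricing A₀ lam P₀ μ σ W) T P = LVFplus σ Δt δ) ∧
    LVFplus σ Δt δ ≤ LVF (mispricing A₀ lam P₀ μ σ W) T P := by
  have hr : Fact (0 < 1 / Δt) := ⟨by positivity⟩
  have ha := ladderRate_pos hσ hΔ δ
  have ha' : Fact (0 < ladderRate σ Δt δ) := ⟨ha⟩
  have hb' : Fact (0 < ladderRate σ Δt δ + 2 * δ / σ ^ 2) := ⟨by positivity⟩
  have hab := ladderRate_mul hσ hΔ δ
  have hba : (ladderRate σ Δt δ + 2 * δ / σ ^ 2 - ladderRate σ Δt δ) * σ ^ 2 = 2 * δ := by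
    field_simp
    ring
  set z := mispricing A₀ lam P₀ μ σ W with hz
  obtain ⟨X, hX, hlaw, hind, hwalk⟩ := exists_iid_steps hW hT hWT δ σ
  have hex := ae_exists_walk_nonpos hX hind hlaw (s := δ / σ ^ 2) (by positivity)
    (lintegral_exp_stepLaw_lt_one hσ.ne' hδ) (Real.log (A₀ / P₀))
  have hleast : ∀ᵐ ω ∂P, ∀ n, (fun k => X k ω) ∈ survivors (Real.log (A₀ / P₀)) n →
      walk (Real.log (A₀ / P₀)) (fun k => X k ω) n ≤ 0 →
      IsLeast (fillable z T ω) (T n ω) ∧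
        z (T n ω) ω = walk (Real.log (A₀ / P₀)) (fun k => X k ω) n := by
    filter_upwards [hwalk, hT.ae_monotone_blockTime] with ω hω hmono n hs hn
    have hzw : ∀ k, z (T k ω) ω = walk (Real.log (A₀ / P₀)) (fun k => X k ω) k := fun k => by
      rw [hω, hz, mispricing_eq hA hP, hδ']
    have hT' : Monotone (T · ω) := fun i j hij => hmono (Nat.succ_le_succ hij)
    exact ⟨isLeast_fillable hT' (fun k hk => (hzw k).symm ▸ hs k hk) ((hzw n).symm ▸ hn), hzw n⟩
  have hfill : ∀ᵐ ω ∂P, ∀ n, (fun k => X k ω) ∈ survivors (Real.log (A₀ / P₀)) n →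
      walk (Real.log (A₀ / P₀)) (fun k => X k ω) n ≤ 0 →
      relativeLoss z T ω = 1 - Real.exp (walk (Real.log (A₀ / P₀)) (fun k => X k ω) n) := by
    filter_upwards [hleast] with ω hω n hs hn
    obtain ⟨h, hzn⟩ := hω n hs hn
    rw [relativeLoss, fillTime, h.csInf_eq, hzn]
  obtain ⟨hint, hval⟩ := integral_reward_at_first_passage hX hind hlaw ha
    (fun s hs => integral_stepReward_sub_stepLaw_of_nonneg hσ.ne' hab hba hs) hex hfill
  change LVF z T P = _ at hval
  rw [hval, LVFplus_eq hδ]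
  refine ⟨?_, hint, fun hz0 => integral_stepReward_sub_stepLaw_of_nonneg hσ.ne' hab hba hz0,
    le_integral_stepReward_sub_stepLaw hσ.ne' hab hba _⟩
  filter_upwards [hex, hleast] with ω hω hl
  classical
  have h := (hl (Nat.find hω) (fun k hk => not_le.1 (Nat.find_min hω hk)) (Nat.find_spec hω)).1
  rw [fillTime, h.csInf_eq]
  exact h

end

end DutchAuction

theorem mainTheorem5 (σ : ℝ) (hσ : 0 < σ) :
    -- the lower bound is asymptotic to `σ √(Δt / 2)` for fast blocks
    (fun Δt : ℝ => DutchAuction.LVFfloor σ Δt)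
      ~[𝓝[>] (0 : ℝ)] (fun Δt : ℝ => σ * Real.sqrt (Δt / 2)) ∧
    ∀ Δt : ℝ, 0 < Δt →
      -- `LVF₊` is strictly increasing in the drift, with limit the lower bound at zero drift
      StrictMonoOn (fun δ : ℝ => DutchAuction.LVFplus σ Δt δ) (Set.Ioi 0) ∧
      Tendsto (fun δ : ℝ => DutchAuction.LVFplus σ Δt δ) (𝓝[>] (0 : ℝ))
        (𝓝 (DutchAuction.LVFfloor σ Δt)) ∧
      (∀ δ : ℝ, 0 < δ → DutchAuction.LVFfloor σ Δt ≤ DutchAuction.LVFplus σ Δt δ) ∧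
      -- the auction model
      ∀ (Ω : Type u) [MeasurableSpace Ω] (Pr : Measure Ω) [IsProbabilityMeasure Pr]
        (W : ℝ≥0 → Ω → ℝ) (T : ℕ → Ω → ℝ≥0),
        IsBrownianReal W Pr →
        DutchAuction.IsPoissonArrivals T (1 / Δt) Pr →
        IndepFun (fun ω t => W t ω) (fun ω n => T n ω) Pr →
        ∀ A₀ lam P₀ μ : ℝ, 0 < A₀ → 0 < lam → 0 < P₀ → 0 < lam + μ - σ ^ 2 / 2 →
          let δ := lam + μ - σ ^ 2 / 2
          let z := DutchAuction.mispricing A₀ lam P₀ μ σ W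
          -- the fill time exists almost surely and the loss has an expectation
          (∀ᵐ ω ∂Pr, IsLeast (DutchAuction.fillable z T ω) (DutchAuction.fillTime z T ω)) ∧
          Integrable (DutchAuction.relativeLoss z T) Pr ∧
          -- `LVF₊` is the common value of `LVF(z₀)` for `z₀ ≥ 0`
          (0 ≤ Real.log (A₀ / P₀) → DutchAuction.LVF z T Pr = DutchAuction.LVFplus σ Δt δ) ∧
          -- the two bounds, for every `z₀`
          DutchAuction.LVFfloor σ Δt ≤ DutchAuction.LVFplus σ Δt δ ∧
          DutchAuction.LVFplus σ Δt δ ≤ DutchAuction.LVF z T Pr := by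
  open DutchAuction in
  refine ⟨isEquivalent_LVFfloor hσ, fun Δt hΔ => ⟨strictMonoOn_LVFplus hσ hΔ,
    tendsto_LVFplus hσ hΔ, fun δ hδ => LVFfloor_le_LVFplus hσ hΔ hδ, ?_⟩⟩
  intro Ω _ Pr _ W T hW hT hWT A₀ lam P₀ μ hA _ hP hδ δ z
  obtain ⟨hfill, hint, heq, hle⟩ := fillTime_and_LVF_spec hσ hΔ hW hT hWT hA hP hδ rfl
  exact ⟨hfill, hint, heq, LVFfloor_le_LVFplus hσ hΔ hδ, hle⟩
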